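/- Let $\mathcal C$ be a clutter on the vertex set $X=\{x_1,\dots,x_n\}$, i.e. a family $\{S_1,\dots,S_q\}$ of subsets of $X$ (the edges), none of which is included in another. Let $K$ be a field, $R=K[x_1,\dots,x_n]$, let $v_j=\sum_{x_i\in S_j}e_i\in\{0,1\}^n$, let $A$ be the $n\times q$ incidence matrix with columns $v_1,\dots,v_q$, and let $I=(x^{v_1},\dots,x^{v_q})\subset R$ be the edge ideal of $\mathcal C$. Let $$Q(A)=\{x\in\mathbb R^n \mid x\ge 0,\ xA\ge \mathbf 1\}$$ be the set covering polyhedron, called *integral* if all its vertices (extreme points) have integer coordinates. Let $\mathbb R_+\mathcal A'\subset\mathbb R^{n+1}$ be the Rees cone of $I$, i.e. the set of linear combinations with non-negative real coefficients of $e_1,\dots,e_n,(v_1,1),\dots,(v_q,1)$. For $a\in\mathbb R^{n+1}$ put $H_a^+=\{x\in\mathbb R^{n+1}\mid\langle x,a\rangle\ge 0\}$. Let $C_1,\dots,C_s\subset X$ be the minimal vertex covers of $\mathcal C$ (the inclusion-minimal sets that meet every edge) and $\ell_k=\bigl(\sum_{x_i\in C_k}e_i,\,-1\bigr)\in\mathbb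 R^{n+1}$ for $k=1,\dots,s$. Let $R[It]=\bigoplus_{i\ge 0}I^it^i\subset R[t]$ be the Rees algebra of $I$ and $\overline{R[It]}$ its integral closure in its field of fractions. For $i\ge 0$ let $I^{(i)}=\bigcap_{\mathfrak p}\mathfrak p^i$, where $\mathfrak p$ runs over the minimal primes of $I$ (an empty intersection being $R$), and let $R_s(I)=\bigoplus_{i\ge 0}I^{(i)}t^i\subset R[t]$ be the symbolic Rees algebra. For an ideal $J\subset R$ let $\overline J$ denote its integral closure, i.e. the set of all $f\in R$ satisfying an equation $f^m+a_1f^{m-1}+\dots+a_m=0$ with $m\ge 1$ and $a_k\in J^k$ for all $k$. Then the following conditions are equivalent: (a) $Q(A)$ is integral. (b) $\mathbb R_+\mathcal A'=H^+_{e_1}\cap\dots\cap H^+_{e_{n+1}}\cap H^+_{\ell_1}\cap\dots\cap H^+_{\ell_s}$. (c) $\overline{R[It]}=R_s(I)$. (c') $\overline{I^i}=I^{(i)}$ for all $i\ge 1$. -/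

import Mathlib

open scoped NNReal Matrix Polynomial

/-- A clutter with vertex set `{x_1, …, x_n}` (indexed by `Fin n`): a family of subsets of the
vertex set, called edges, none of which is included in another. -/
structure Clutter (n : ℕ) where
  edges : Finset (Finset (Fin n))
  antichain : IsAntichain (· ⊆ ·) (edges : Set (Finset (Fin n)))

/-- The set covering polyhedron `Q(A) = {x ∈ ℝⁿ | x ≥ 0, xA ≥ 1}`. -/
def setCoveringPolyhedron {n : ℕ} {ι : Type*} (A : Matrix (Fin n) ι ℕ) : Set (Fin n → ℝ) :=
  {x | 0 ≤ x ∧ 1 ≤ x ᵥ* A.map (fun a : ℕ => (a : ℝ))}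

/-- `Q` has only integral vertices. -/
def HasOnlyIntegralVertices {n : ℕ} (Q : Set (Fin n → ℝ)) : Prop :=
  ∀ x ∈ Set.extremePoints ℝ Q, ∀ i, ∃ z : ℤ, x i = z

/-- The generators `e_1, …, e_n, (v_1, 1), …, (v_q, 1)` in `ℝⁿ⁺¹` of the Rees cone,
where the `v_j` are the columns of `A`. -/
def reesConeGenerators {n : ℕ} {ι : Type*} (A : Matrix (Fin n) ι ℕ) : Set (Fin (n + 1) → ℝ) :=
  Set.range (fun i : Fin n => Pi.single (Fin.castSucc i) (1 : ℝ)) ∪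
    Set.range (fun j : ι => Fin.snoc (α := fun _ => ℝ) (fun i : Fin n => (A i j : ℝ)) 1)

/-- The Rees cone: all linear combinations of the generators with non-negative real coefficients. -/
def reesCone {n : ℕ} {ι : Type*} (A : Matrix (Fin n) ι ℕ) : Set (Fin (n + 1) → ℝ) :=
  (Submodule.span ℝ≥0 (reesConeGenerators A) : Set (Fin (n + 1) → ℝ))

/-- The closed half-space `H_a⁺ = {x | ⟨x, a⟩ ≥ 0}`. -/
def posHalfSpace {m : ℕ} (a : Fin m → ℝ) : Set (Fin m → ℝ) :=
  {x | 0 ≤ x ⬝ᵥ a}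

/-- The vector `ℓ = (∑_{x_i ∈ S} e_i, -1)` attached to a set `S` of vertices. -/
def coverVector {n : ℕ} (S : Finset (Fin n)) : Fin (n + 1) → ℝ :=
  Fin.snoc (α := fun _ => ℝ) (∑ i ∈ S, Pi.single i (1 : ℝ)) (-1)

namespace Clutter

/-- The incidence matrix: rows indexed by the vertices, columns by the edges. -/
def incidenceMatrix {n : ℕ} (C : Clutter n) : Matrix (Fin n) C.edges ℕ :=
  Matrix.of fun i S => if i ∈ (S : Finset (Fin n)) then 1 else 0

/-- A set of vertices that meets every edge. -/
def IsVertexCover {n : ℕ} (C : Clutter n) (S : Finset (Fin n)) : Prop :=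
  ∀ e ∈ C.edges, ∃ i ∈ e, i ∈ S

/-- A vertex cover that is minimal with respect to inclusion. -/
def IsMinimalVertexCover {n : ℕ} (C : Clutter n) (S : Finset (Fin n)) : Prop :=
  Minimal C.IsVertexCover S

/-- The edge ideal in `K[x_1, …, x_n]`, generated by the monomials `∏_{x_i ∈ e} x_i`, `e` an
edge. -/
noncomputable def edgeIdeal {n : ℕ} (C : Clutter n) (K : Type*) [Field K] :
    Ideal (MvPolynomial (Fin n) K) :=
  Ideal.span ((fun e : Finset (Fin n) => ∏ i ∈ e, MvPolynomial.X i) '' C.edges)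

end Clutter

/-- The `i`-th symbolic power `I⁽ⁱ⁾`, the intersection of the `𝔭ⁱ` over the minimal primes `𝔭`
of `I`. -/
def symbolicPow {R : Type*} [CommRing R] (I : Ideal R) (i : ℕ) : Ideal R :=
  ⨅ p ∈ I.minimalPrimes, p ^ i

/-- The symbolic Rees algebra `R + I⁽¹⁾t + I⁽²⁾t² + ⋯ ⊆ R[t]`. -/
def symbolicReesAlgebra {R : Type*} [CommRing R] (I : Ideal R) : Subalgebra R R[X] where
  carrier := {f | ∀ i, f.coeff i ∈ symbolicPow I i}
  mul_mem' {f g} hf hg i := by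
    simp only [symbolicPow, Ideal.mem_iInf, Set.mem_ofPred_eq] at hf hg ⊢
    intro p hp
    exact (reesAlgebra p).mul_mem (x := f) (y := g) (fun j => hf j p hp) (fun j => hg j p hp) i
  add_mem' hf hg i := by
    rw [Polynomial.coeff_add]
    exact Ideal.add_mem _ (hf i) (hg i)
  algebraMap_mem' r i := by
    simp only [symbolicPow, Ideal.mem_iInf]
    intro p _
    exact (reesAlgebra p).algebraMap_mem r i

/-- The integral closure of the Rees algebra `R[It]` in its field of fractions. The latter is
realised as the subfield generated by `R[It]` in the field of fractions of `R[t]`. -/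
def integralClosureReesAlgebra {R : Type*} [CommRing R] [IsDomain R] (I : Ideal R) :
    Set (FractionRing R[X]) :=
  {z | z ∈ Subfield.closure
        (algebraMap R[X] (FractionRing R[X]) '' (reesAlgebra I : Set R[X])) ∧
      IsIntegral (reesAlgebra I) z}

/-- The integral closure of an ideal `J`: the elements `x` satisfying an equation
`x^m + a_1 x^(m-1) + ⋯ + a_m = 0` with `m ≥ 1` and `a_k ∈ J^k`. -/
def integralClosureIdeal {R : Type*} [CommRing R] (J : Ideal R) : Set R :=
  {x | ∃ m : ℕ, 1 ≤ m ∧ ∃ a : ℕ → R, (∀ k, a k ∈ J ^ k) ∧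
      x ^ m + ∑ k ∈ Finset.Icc 1 m, a k * x ^ (m - k) = 0}

/-! ### Linear programming duality for the Rees cone -/

section Polyhedral

variable {n : ℕ} (C : Clutter n)

/-! The geometric half is linear programming duality. By weak duality (`sum_weights_le_sum_mul`) and
Farkas (`exists_mem_setCoveringPolyhedron_lt`), a point `(y, t)` with `y, t ≥ 0` lies in the Rees
cone iff `⟨x, y⟩ ≥ t` for all `x ∈ Q(A)`. The right side of (b) asks this only for the indicators of
minimal covers. Hence (b) says that non-negative functionals cannot distinguish `Q(A)` from the
convex hull of these indicators plus the orthant, which amounts to integrality of the vertices.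

The algebraic half is a dictionary for monomials. Minimal primes of `I` are generated by the
variables of minimal covers, so `x^m t^k ∈ R_s(I)` iff `(m, k)` satisfies the inequalities of (b).
And `x^m t^k` is integral over `R[It]` iff `(m, k)` is in the Rees cone: comparing coefficients in
an integral equation puts some `x^(jm)`, `j ≥ 1`, in `I^(jk)`, and conversely Diophantine
approximation of real edge weights yields such a power. Integral elements always lie in `R_s(I)`, by
a valuation argument for each cover. So (c) and (c') compare integral points of the two cones, and
rounding (`reesCone_eq_of_natCast_mem`) recovers (b). -/

theorem mem_setCoveringPolyhedron_iff {x : Fin n → ℝ} :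
    x ∈ setCoveringPolyhedron C.incidenceMatrix ↔
      (∀ i, 0 ≤ x i) ∧ ∀ e ∈ C.edges, 1 ≤ ∑ i ∈ e, x i := by
  simp [setCoveringPolyhedron, Pi.le_def, Matrix.vecMul, dotProduct, Clutter.incidenceMatrix]

/-- Only the coefficients of the edge generators matter: those of the `e_i` are the slack in the
coordinate inequalities. -/
theorem mem_reesCone_iff {z : Fin (n + 1) → ℝ} :
    z ∈ reesCone C.incidenceMatrix ↔
      ∃ w : C.edges → ℝ, (∀ e, 0 ≤ w e) ∧ ∑ e, w e = z (Fin.last n) ∧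
        ∀ i : Fin n, (∑ e : C.edges, if i ∈ e.1 then w e else 0) ≤ z i.castSucc := by
  constructor
  · intro hz
    refine Submodule.span_induction
      (p := fun z _ => ∃ w : C.edges → ℝ, (∀ e, 0 ≤ w e) ∧ ∑ e, w e = z (Fin.last n) ∧
        ∀ i : Fin n, (∑ e : C.edges, if i ∈ e.1 then w e else 0) ≤ z i.castSucc)
      ?_ ?_ ?_ ?_ hz
    · rintro x (⟨i, rfl⟩ | ⟨e, rfl⟩)
      · refine ⟨0, by simp, by simp [(Fin.castSucc_lt_last i).ne'], fun j => ?_⟩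
        simp only [Pi.zero_apply, ite_self, Finset.sum_const_zero, Pi.single_apply]
        split_ifs <;> norm_num
      · refine ⟨Pi.single e 1, fun f => ?_, by simp, fun i => ?_⟩
        · rw [Pi.single_apply]; split_ifs <;> norm_num
        · refine le_of_eq ((Finset.sum_eq_single_of_mem e (Finset.mem_univ _) fun f _ hf => ?_).trans ?_)
          · simp [hf]
          · simp [Clutter.incidenceMatrix]
    · exact ⟨0, by simp, by simp, by simp⟩
    · rintro x y _ _ ⟨w, h0, h1, h2⟩ ⟨w', h0', h1', h2'⟩
      refine ⟨w + w', fun e => add_nonneg (h0 e) (h0' e), ?_, fun i => ?_⟩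
      · simp [Finset.sum_add_distrib, h1, h1', -Finset.univ_eq_attach]
      · refine le_trans (le_of_eq ?_) (add_le_add (h2 i) (h2' i))
        rw [← Finset.sum_add_distrib]
        exact Finset.sum_congr rfl fun e _ => by split_ifs <;> simp
    · rintro a x _ ⟨w, h0, h1, h2⟩
      refine ⟨(a : ℝ) • w, fun e => mul_nonneg a.2 (h0 e), ?_, fun i => ?_⟩
      · simp [← Finset.mul_sum, h1, NNReal.smul_def, -Finset.univ_eq_attach]
      · refine le_trans (le_of_eq ?_) (mul_le_mul_of_nonneg_left (h2 i) a.2)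
        rw [Finset.mul_sum]
        exact Finset.sum_congr rfl fun e _ => by split_ifs <;> simp
  · rintro ⟨w, h0, h1, h2⟩
    have key : z = (∑ e : C.edges, (⟨w e, h0 e⟩ : ℝ≥0) •
          (Fin.snoc (α := fun _ => ℝ) (fun i : Fin n => (C.incidenceMatrix i e : ℝ)) 1)) +
        ∑ i : Fin n, (⟨z i.castSucc - ∑ e : C.edges, (if i ∈ e.1 then w e else 0),
          sub_nonneg.2 (h2 i)⟩ : ℝ≥0) • (Pi.single (Fin.castSucc i) (1 : ℝ)) := by
      ext j
      refine Fin.lastCases ?_ (fun j => ?_) j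
      · simp [h1, (Fin.castSucc_lt_last _).ne', -Finset.univ_eq_attach]
      · simp [Pi.single_apply, Clutter.incidenceMatrix]
    rw [key]
    refine Submodule.add_mem _ (Submodule.sum_mem _ fun e _ => Submodule.smul_mem _ _ ?_)
      (Submodule.sum_mem _ fun i _ => Submodule.smul_mem _ _ ?_)
    · exact Submodule.subset_span (Or.inr ⟨e, rfl⟩)
    · exact Submodule.subset_span (Or.inl ⟨i, rfl⟩)

theorem dotProduct_coverVector (S : Finset (Fin n)) (z : Fin (n + 1) → ℝ) :
    z ⬝ᵥ coverVector S = ∑ i ∈ S, z i.castSucc - z (Fin.last n) := by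
  simp [dotProduct, coverVector, Fin.sum_univ_castSucc, Finset.sum_apply, Pi.single_apply,
    sub_eq_add_neg]

theorem mem_iInter_posHalfSpace_iff {z : Fin (n + 1) → ℝ} :
    z ∈ (⋂ i : Fin (n + 1), posHalfSpace (Pi.single i (1 : ℝ))) ∩
          ⋂ (S : Finset (Fin n)) (_ : C.IsMinimalVertexCover S), posHalfSpace (coverVector S) ↔
      (∀ i : Fin n, 0 ≤ z i.castSucc) ∧ 0 ≤ z (Fin.last n) ∧
        ∀ S, C.IsMinimalVertexCover S → z (Fin.last n) ≤ ∑ i ∈ S, z i.castSucc := by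
  have h : (∀ i, 0 ≤ z i) ↔ (∀ i : Fin n, 0 ≤ z i.castSucc) ∧ 0 ≤ z (Fin.last n) :=
    ⟨fun h => ⟨fun i => h _, h _⟩, fun h i => Fin.lastCases h.2 h.1 i⟩
  simp [posHalfSpace, dotProduct_coverVector, h, and_assoc]

/-- Weak duality between edge packings bounded by `y` and the set covering polyhedron. -/
theorem sum_weights_le_sum_mul {w : C.edges → ℝ} {x y : Fin n → ℝ} (hw : ∀ e, 0 ≤ w e)
    (hx : ∀ i, 0 ≤ x i) {a : ℝ} (hxe : ∀ e ∈ C.edges, a ≤ ∑ i ∈ e, x i)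
    (hwy : ∀ i : Fin n, (∑ e : C.edges, if i ∈ e.1 then w e else 0) ≤ y i) :
    a * ∑ e, w e ≤ ∑ i, x i * y i := by
  calc a * ∑ e, w e = ∑ e, w e * a := by rw [Finset.mul_sum]; simp [mul_comm]
    _ ≤ ∑ e : C.edges, w e * ∑ i ∈ e.1, x i :=
        Finset.sum_le_sum fun e _ => mul_le_mul_of_nonneg_left (hxe e e.2) (hw e)
    _ = ∑ e : C.edges, ∑ i, x i * if i ∈ e.1 then w e else 0 :=
        Finset.sum_congr rfl fun e _ => by simp [Finset.mul_sum, mul_comm, Finset.sum_ite_mem]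
    _ = ∑ i, x i * ∑ e : C.edges, if i ∈ e.1 then w e else 0 := by
        rw [Finset.sum_comm]; simp [Finset.mul_sum]
    _ ≤ _ := Finset.sum_le_sum fun i _ => mul_le_mul_of_nonneg_left (hwy i) (hx i)

theorem Clutter.IsVertexCover.exists_minimal {C : Clutter n} {S : Finset (Fin n)}
    (h : C.IsVertexCover S) : ∃ T ⊆ S, C.IsMinimalVertexCover T := by
  obtain ⟨T, hT, hm⟩ := exists_minimal_le_of_wellFoundedLT C.IsVertexCover S h
  exact ⟨T, hT, hm⟩

/-- Weak duality, applied to the indicator of a cover. -/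
theorem reesCone_subset :
    reesCone C.incidenceMatrix ⊆ (⋂ i : Fin (n + 1), posHalfSpace (Pi.single i (1 : ℝ))) ∩
          ⋂ (S : Finset (Fin n)) (_ : C.IsMinimalVertexCover S), posHalfSpace (coverVector S) := by
  intro z hz
  obtain ⟨w, h0, h1, h2⟩ := (mem_reesCone_iff C).1 hz
  refine (mem_iInter_posHalfSpace_iff C).2 ⟨fun i => le_trans ?_ (h2 i), ?_, fun S hS => ?_⟩
  · exact Finset.sum_nonneg fun e _ => by split_ifs <;> simp [h0]
  · rw [← h1]; exact Finset.sum_nonneg fun e _ => h0 e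
  · have := sum_weights_le_sum_mul C (w := w) (x := fun i => if i ∈ S then 1 else 0) (a := 1)
      (y := fun i => z i.castSucc) h0 (fun i => by split_ifs <;> simp) ?_ h2
    · simpa [h1, -Finset.univ_eq_attach] using this
    · intro e he
      obtain ⟨i, hie, hiS⟩ := hS.1 e he
      have := Finset.single_le_sum (f := fun i => if i ∈ S then (1 : ℝ) else 0)
        (fun i _ => by split_ifs <;> simp) hie
      simpa [hiS] using this

/-- A point that dominates no point of a compact convex set is separated from it by a
non-negative functional. -/
theorem exists_nonneg_separating {K : Set (Fin n → ℝ)} (hK : Convex ℝ K) (hKc : IsCompact K)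
    {y : Fin n → ℝ} (h : ∀ c ∈ K, ¬ c ≤ y) :
    ∃ (x : Fin n → ℝ) (a : ℝ), (∀ i, 0 ≤ x i) ∧ ∑ i, x i * y i < a ∧
      ∀ c ∈ K, a < ∑ i, x i * c i := by
  obtain ⟨f, u, v, hu, huv, hv⟩ := geometric_hahn_banach_compact_closed hK hKc
    (convex_Iic y) isClosed_Iic (Set.disjoint_left.2 h)
  have hf : ∀ z : Fin n → ℝ, f z = ∑ i, f (Pi.single i 1) * z i := by
    intro z
    conv_lhs => rw [← Finset.univ_sum_single z]
    rw [map_sum]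
    refine Finset.sum_congr rfl fun i _ => ?_
    have : Pi.single i (z i) = z i • (Pi.single i 1 : Fin n → ℝ) := by
      rw [← Pi.single_smul]; simp
    rw [this, map_smul, smul_eq_mul, mul_comm]
  refine ⟨fun i => - f (Pi.single i 1), -u, fun i => ?_, ?_, fun c hc => ?_⟩
  · by_contra! hneg
    have hp : 0 < f (Pi.single i 1) := by linarith
    -- Lowering coordinate `i` of `y` by `r` stays in the orthant below `y` but brings `f` down to
    -- at most `v`.
    set r := (|f y - v|) / f (Pi.single i 1)
    have hr : 0 ≤ r := by positivity
    have h1 := hv (y - r • Pi.single i 1) (by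
      intro j
      simp only [Pi.sub_apply, Pi.smul_apply, smul_eq_mul, Pi.single_apply]
      split_ifs <;> simp [hr])
    rw [map_sub, map_smul, smul_eq_mul, div_mul_cancel₀ _ hp.ne'] at h1
    linarith [le_abs_self (f y - v)]
  · have := hv y (Set.mem_Iic.2 le_rfl)
    rw [hf] at this
    simp only [neg_mul, Finset.sum_neg_distrib]
    linarith
  · have := hu c hc
    rw [hf] at this
    simp only [neg_mul, Finset.sum_neg_distrib]
    linarith

/-- Farkas' lemma for the Rees cone. -/
theorem exists_mem_setCoveringPolyhedron_lt {z : Fin (n + 1) → ℝ}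
    (hz0 : ∀ i : Fin n, 0 ≤ z i.castSucc) (ht : 0 ≤ z (Fin.last n))
    (hz : z ∉ reesCone C.incidenceMatrix) :
    ∃ x ∈ setCoveringPolyhedron C.incidenceMatrix, ∑ i, x i * z i.castSucc < z (Fin.last n) := by
  have ht : 0 < z (Fin.last n) := by
    refine lt_of_le_of_ne ht fun h => hz ((mem_reesCone_iff C).2 ⟨0, by simp, by simp [← h], ?_⟩)
    simpa using hz0
  set t := z (Fin.last n)
  let φ : (C.edges → ℝ) →ₗ[ℝ] (Fin n → ℝ) :=
    LinearMap.pi fun i => ∑ e : C.edges, if i ∈ e.1 then LinearMap.proj e else 0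
  have hφ : ∀ w i, φ w i = ∑ e : C.edges, if i ∈ e.1 then w e else 0 := by
    intro w i
    simp only [φ, LinearMap.pi_apply, LinearMap.sum_apply]
    exact Finset.sum_congr rfl fun e _ => by split_ifs <;> simp
  -- The image of the simplex is the convex hull of the edge vectors; a point of it below `z / t`
  -- (first `n` coordinates) would, scaled by `t`, put `z` in the cone. Dividing the separating
  -- functional by `a` then lands in `Q(A)`.
  obtain ⟨x, a, hx0, hxy, hxe⟩ := exists_nonneg_separating
    (K := φ '' stdSimplex ℝ C.edges) (y := fun i => t⁻¹ * z i.castSucc)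
    ((convex_stdSimplex ℝ C.edges).linear_image φ)
    ((isCompact_stdSimplex ℝ C.edges).image φ.continuous_of_finiteDimensional) (by
      rintro _ ⟨w, ⟨hw0, hw1⟩, rfl⟩ hle
      refine hz ((mem_reesCone_iff C).2 ⟨t • w, fun e => mul_nonneg ht.le (hw0 e), ?_, ?_⟩)
      · simp [← Finset.mul_sum, hw1, t, -Finset.univ_eq_attach]
      · intro i
        have := hle i
        rw [hφ] at this
        calc _ = t * ∑ e : C.edges, (if i ∈ e.1 then w e else 0) := by
              rw [Finset.mul_sum]
              exact Finset.sum_congr rfl fun e _ => by split_ifs <;> simp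
          _ ≤ t * (t⁻¹ * z i.castSucc) := mul_le_mul_of_nonneg_left this ht.le
          _ = _ := by field_simp)
  have ha : 0 < a := lt_of_le_of_lt
    (Finset.sum_nonneg fun i _ => mul_nonneg (hx0 i)
      (mul_nonneg (inv_nonneg.2 ht.le) (hz0 i))) hxy
  refine ⟨fun i => a⁻¹ * x i, (mem_setCoveringPolyhedron_iff C).2
    ⟨fun i => mul_nonneg (inv_nonneg.2 ha.le) (hx0 i), fun e he => ?_⟩, ?_⟩
  · have := hxe _ ⟨Pi.single ⟨e, he⟩ 1, single_mem_stdSimplex ℝ _, rfl⟩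
    simp only [hφ, Pi.single_apply] at this
    rw [← Finset.mul_sum, ← div_eq_inv_mul, one_le_div ha]
    refine this.le.trans (le_of_eq ?_)
    have h2 : ∀ i, (∑ f : C.edges, if i ∈ f.1 then (if f = ⟨e, he⟩ then (1 : ℝ) else 0) else 0) =
        if i ∈ e then 1 else 0 := fun i =>
      (Finset.sum_eq_single_of_mem ⟨e, he⟩ (Finset.mem_univ _) fun f _ hf => by simp [hf]).trans
        (by simp)
    simp only [h2]
    simp [Finset.sum_ite_mem]
  · have h1 : ∑ i, a⁻¹ * x i * z i.castSucc = a⁻¹ * t * ∑ i, x i * (t⁻¹ * z i.castSucc) := by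
      rw [Finset.mul_sum]
      exact Finset.sum_congr rfl fun i _ => by field_simp
    rw [h1]
    calc _ < a⁻¹ * t * a := mul_lt_mul_of_pos_left hxy (by positivity)
      _ = t := by field_simp

end Polyhedral

/-! ### Vertices of the covering polyhedron and the cone equality -/

section Integrality

variable {n : ℕ} (C : Clutter n)

theorem convex_setCoveringPolyhedron : Convex ℝ (setCoveringPolyhedron C.incidenceMatrix) := by
  intro x hx y hy a b ha hb hab
  rw [mem_setCoveringPolyhedron_iff] at hx hy ⊢
  refine ⟨fun i => add_nonneg (mul_nonneg ha (hx.1 i)) (mul_nonneg hb (hy.1 i)), fun e he => ?_⟩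
  have h : ∑ i ∈ e, (a • x + b • y) i = a * ∑ i ∈ e, x i + b * ∑ i ∈ e, y i := by
    simp [Finset.sum_add_distrib, Finset.mul_sum]
  rw [h]
  nlinarith [hx.2 e he, hy.2 e he]

theorem isClosed_setCoveringPolyhedron :
    IsClosed (setCoveringPolyhedron C.incidenceMatrix) := by
  have h : Continuous fun x : Fin n → ℝ =>
      x ᵥ* C.incidenceMatrix.map (fun a : ℕ => (a : ℝ)) :=
    continuous_id.matrix_vecMul continuous_const
  exact (isClosed_le continuous_const continuous_id).inter (isClosed_le continuous_const h)

theorem inf_one_mem_setCoveringPolyhedron {x : Fin n → ℝ}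
    (hx : x ∈ setCoveringPolyhedron C.incidenceMatrix) :
    x ⊓ 1 ∈ setCoveringPolyhedron C.incidenceMatrix := by
  rw [mem_setCoveringPolyhedron_iff] at hx ⊢
  have h0 : ∀ i, 0 ≤ (x ⊓ 1) i := fun i => le_inf (hx.1 i) zero_le_one
  refine ⟨h0, fun e he => ?_⟩
  by_cases h : ∃ i ∈ e, 1 ≤ x i
  · obtain ⟨i, hi, h1⟩ := h
    have h2 : (x ⊓ 1) i = 1 := inf_eq_right.2 h1
    rw [← h2]
    exact Finset.single_le_sum (fun i _ => h0 i) hi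
  · push Not at h
    refine (hx.2 e he).trans (Finset.sum_le_sum fun i hi => ?_)
    exact le_inf le_rfl (h i hi).le

/-- A strictly positive functional on the set covering polyhedron is bounded below by its value
at some vertex. -/
theorem exists_extremePoint_sum_mul_le {y : Fin n → ℝ} (hy : ∀ i, 0 < y i) {x : Fin n → ℝ}
    (hx : x ∈ setCoveringPolyhedron C.incidenceMatrix) :
    ∃ w ∈ Set.extremePoints ℝ (setCoveringPolyhedron C.incidenceMatrix),
      ∑ i, w i * y i ≤ ∑ i, x i * y i := by
  set Q := setCoveringPolyhedron C.incidenceMatrix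
  -- Truncation at `1` maps `Q` into this compact part without increasing the functional, so a
  -- minimum exists and is attained at an extreme point of `P`.
  set P := Q ∩ Set.Icc 0 1
  have hPc : IsCompact P := isCompact_Icc.inter_left (isClosed_setCoveringPolyhedron C)
  have hinf : ∀ z ∈ Q, z ⊓ 1 ∈ P := fun z hz =>
    ⟨inf_one_mem_setCoveringPolyhedron C hz, le_inf hz.1 zero_le_one, inf_le_right⟩
  let l : StrongDual ℝ (Fin n → ℝ) := ∑ i, (-y i) • ContinuousLinearMap.proj i
  have hl : ∀ z, l z = - ∑ i, z i * y i := by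
    intro z
    simp [l, mul_comm]
  let F := {z ∈ P | ∀ z' ∈ P, l z' ≤ l z}
  have hF : IsExposed ℝ P F := fun _ => ⟨l, rfl⟩
  obtain ⟨z, hzP, hz⟩ := hPc.exists_isMaxOn ⟨_, hinf x hx⟩ l.continuous.continuousOn
  obtain ⟨w, hwF⟩ := (hF.isCompact hPc).extremePoints_nonempty ⟨z, hzP, hz⟩
  have hwP := hF.isExtreme.extremePoints_subset_extremePoints hwF
  have hmin : ∀ z ∈ P, ∑ i, w i * y i ≤ ∑ i, z i * y i := by
    intro z hz
    have := hwF.1.2 z hz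
    rw [hl, hl] at this
    linarith
  refine ⟨w, ⟨hwP.1.1, ?_⟩, (hmin _ (hinf x hx)).trans ?_⟩
  -- Extremality passes from `P` to `Q`: truncating the endpoints of a segment through `w` gives a
  -- point of `P` below `w`. As `y > 0`, minimality forces equality, so nothing was truncated and
  -- the endpoints lie in `P`.
  · rintro a ha b hb ⟨s, t, hs, ht, hst, hw⟩
    have hconv : s • (a ⊓ 1) + t • (b ⊓ 1) ∈ P :=
      ⟨convex_setCoveringPolyhedron C (hinf a ha).1 (hinf b hb).1 hs.le ht.le hst,
        convex_Icc _ _ (hinf a ha).2 (hinf b hb).2 hs.le ht.le hst⟩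
    have hle : ∀ i, s * (a ⊓ 1) i + t * (b ⊓ 1) i ≤ w i := by
      intro i
      rw [← hw]
      exact add_le_add (mul_le_mul_of_nonneg_left inf_le_left hs.le)
        (mul_le_mul_of_nonneg_left inf_le_left ht.le)
    have heq : ∀ i, s * (a ⊓ 1) i + t * (b ⊓ 1) i = w i := by
      intro i
      by_contra hne
      refine absurd (hmin _ hconv) (not_le.2 (Finset.sum_lt_sum (fun j _ => ?_)
        ⟨i, Finset.mem_univ _, ?_⟩))
      · exact mul_le_mul_of_nonneg_right (hle j) (hy j).le
      · exact mul_lt_mul_of_pos_right (lt_of_le_of_ne (hle i) hne) (hy i)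
    have hab : ∀ i, a i ≤ 1 ∧ b i ≤ 1 := by
      intro i
      have h1 := heq i
      have h2 : w i = s * a i + t * b i := by rw [← hw]; rfl
      have h3 : (a ⊓ 1) i ≤ a i := inf_le_left
      have h4 : (b ⊓ 1) i ≤ b i := inf_le_left
      have h5 : (a ⊓ 1) i ≤ 1 := inf_le_right
      have h6 : (b ⊓ 1) i ≤ 1 := inf_le_right
      constructor
      · nlinarith
      · nlinarith
    have haP : a ∈ P := by
      have : a ⊓ 1 = a := inf_eq_left.2 fun i => (hab i).1
      exact this ▸ hinf a ha
    have hbP : b ∈ P := by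
      have : b ⊓ 1 = b := inf_eq_left.2 fun i => (hab i).2
      exact this ▸ hinf b hb
    exact hwP.2 haP hbP ⟨s, t, hs, ht, hst, hw⟩
  · exact Finset.sum_le_sum fun i _ => mul_le_mul_of_nonneg_right inf_le_left (hy i).le

/-- A point outside the cone violates the inequality of some `x ∈ Q(A)`, hence, after a small
perturbation, that of a vertex. An integral vertex dominates the indicator of a minimal cover, whose
inequality is then violated too. -/
theorem reesCone_eq_of_hasOnlyIntegralVertices
    (h : HasOnlyIntegralVertices (setCoveringPolyhedron C.incidenceMatrix)) :
    reesCone C.incidenceMatrix =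
        (⋂ i : Fin (n + 1), posHalfSpace (Pi.single i (1 : ℝ))) ∩
          ⋂ (S : Finset (Fin n)) (_ : C.IsMinimalVertexCover S), posHalfSpace (coverVector S) := by
  refine (reesCone_subset C).antisymm fun z hz => ?_
  obtain ⟨hz0, ht, hzS⟩ := (mem_iInter_posHalfSpace_iff C).1 hz
  by_contra hzc
  obtain ⟨x, hx, hlt⟩ := exists_mem_setCoveringPolyhedron_lt C hz0 ht hzc
  have hx0 := ((mem_setCoveringPolyhedron_iff C).1 hx).1
  have hs0 : 0 ≤ ∑ i, x i := Finset.sum_nonneg fun i _ => hx0 i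
  -- Adding `ε` makes the functional strictly positive; this value leaves a gap of exactly `ε` at
  -- `x`.
  set ε := (z (Fin.last n) - ∑ i, x i * z i.castSucc) / (1 + ∑ i, x i)
  have hε : 0 < ε := div_pos (by linarith) (by linarith)
  have hεx : ε * (1 + ∑ i, x i) = z (Fin.last n) - ∑ i, x i * z i.castSucc :=
    div_mul_cancel₀ _ (by linarith)
  obtain ⟨w, hw, hwx⟩ := exists_extremePoint_sum_mul_le C (y := fun i => z i.castSucc + ε)
    (fun i => by linarith [hz0 i]) hx
  obtain ⟨hw0, hwe⟩ := (mem_setCoveringPolyhedron_iff C).1 hw.1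
  have hwx' : ∑ i, x i * (z i.castSucc + ε) < z (Fin.last n) := by
    simp only [mul_add, Finset.sum_add_distrib, ← Finset.sum_mul]
    nlinarith
  have hcov : C.IsVertexCover {i | 1 ≤ w i} := by
    intro e he
    have : ∃ i ∈ e, 0 < w i := by
      by_contra! hcon
      linarith [hwe e he, Finset.sum_nonpos hcon]
    obtain ⟨i, hi, hpos⟩ := this
    obtain ⟨k, hk⟩ := h w hw i
    refine ⟨i, hi, Finset.mem_filter.2 ⟨Finset.mem_univ _, ?_⟩⟩
    rw [hk] at hpos ⊢
    exact_mod_cast hpos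
  obtain ⟨T, hT, hTmin⟩ := hcov.exists_minimal
  have h1 : ∑ i ∈ T, z i.castSucc ≤ ∑ i, w i * (z i.castSucc + ε) := by
    refine (Finset.sum_le_sum fun i hi => ?_).trans
      (Finset.sum_le_sum_of_subset_of_nonneg (Finset.subset_univ T) fun i _ _ =>
        mul_nonneg (hw0 i) (by linarith [hz0 i]))
    have := (Finset.mem_filter.1 (hT hi)).2
    nlinarith [hz0 i]
  linarith [hzS T hTmin]

/-- A vertex `w` dominates a convex combination of cover indicators: otherwise a separating pair
`(y, a)` satisfies all cover inequalities, so lies in the cone, against weak duality at `w`.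
Extremality then makes `w` one of the indicators. -/
theorem hasOnlyIntegralVertices_of_reesCone_eq
    (h : reesCone C.incidenceMatrix =
        (⋂ i : Fin (n + 1), posHalfSpace (Pi.single i (1 : ℝ))) ∩
          ⋂ (S : Finset (Fin n)) (_ : C.IsMinimalVertexCover S), posHalfSpace (coverVector S)) :
    HasOnlyIntegralVertices (setCoveringPolyhedron C.incidenceMatrix) := by
  intro w hw
  obtain ⟨hw0, hwe⟩ := (mem_setCoveringPolyhedron_iff C).1 hw.1
  have huniv : C.IsVertexCover Finset.univ := by
    intro e he
    rcases e.eq_empty_or_nonempty with rfl | ⟨i, hi⟩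
    · have := hwe ∅ he
      norm_num at this
    · exact ⟨i, hi, Finset.mem_univ _⟩
  let ind : Finset (Fin n) → Fin n → ℝ := fun S i => if i ∈ S then 1 else 0
  let V : Set (Fin n → ℝ) := ind '' {S | C.IsMinimalVertexCover S}
  have hVfin : V.Finite := (Set.toFinite _).image _
  have hVQ : V ⊆ setCoveringPolyhedron C.incidenceMatrix := by
    rintro _ ⟨S, hS, rfl⟩
    refine (mem_setCoveringPolyhedron_iff C).2
      ⟨fun i => by simp only [ind]; split_ifs <;> simp, fun e he => ?_⟩
    obtain ⟨i, hie, hiS⟩ := hS.1 e he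
    have := Finset.single_le_sum (f := ind S)
      (fun i _ => by simp only [ind]; split_ifs <;> simp) hie
    simpa [ind, hiS] using this
  have hKQ : convexHull ℝ V ⊆ setCoveringPolyhedron C.incidenceMatrix :=
    convexHull_min hVQ (convex_setCoveringPolyhedron C)
  have hdom : ∃ c ∈ convexHull ℝ V, c ≤ w := by
    by_contra! hcon
    obtain ⟨y, a, hy0, hyw, hyc⟩ := exists_nonneg_separating (convex_convexHull ℝ V)
      (hVfin.isCompact_convexHull ℝ) hcon
    have ha : 0 ≤ a := (Finset.sum_nonneg fun i _ => mul_nonneg (hy0 i) (hw0 i)).trans hyw.le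
    have hmem : (Fin.snoc (α := fun _ => ℝ) y a : Fin (n + 1) → ℝ) ∈
        reesCone C.incidenceMatrix := by
      rw [h, mem_iInter_posHalfSpace_iff]
      refine ⟨by simpa using hy0, by simpa using ha, fun S hS => ?_⟩
      have := hyc _ (subset_convexHull ℝ V ⟨S, hS, rfl⟩)
      simpa [ind, Finset.sum_ite_mem] using this.le
    obtain ⟨u, hu0, hu1, hu2⟩ := (mem_reesCone_iff C).1 hmem
    have := sum_weights_le_sum_mul C hu0 hw0 hwe hu2
    rw [hu1] at this
    simp only [Fin.snoc_last, Fin.snoc_castSucc, one_mul, mul_comm (w _)] at this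
    linarith
  obtain ⟨c, hc, hcw⟩ := hdom
  have hcQ := hKQ hc
  -- `w` is the midpoint of `c` and this point.
  have hc2 : w + (w - c) ∈ setCoveringPolyhedron C.incidenceMatrix := by
    have hwc : ∀ i, w i ≤ (w + (w - c)) i := fun i => by
      have := hcw i
      simp only [Pi.add_apply, Pi.sub_apply]
      linarith
    exact (mem_setCoveringPolyhedron_iff C).2 ⟨fun i => (hw0 i).trans (hwc i),
      fun e he => (hwe e he).trans (Finset.sum_le_sum fun i _ => hwc i)⟩
  have hcw' : c = w := hw.2 hcQ hc2 ⟨1 / 2, 1 / 2, by norm_num, by norm_num, by norm_num, by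
    ext i
    simp only [Pi.add_apply, Pi.smul_apply, Pi.sub_apply, smul_eq_mul]
    ring⟩
  subst hcw'
  obtain ⟨S, -, rfl⟩ := extremePoints_convexHull_subset
    (inter_extremePoints_subset_extremePoints_of_subset hKQ ⟨hc, hw⟩)
  intro i
  by_cases hi : i ∈ S
  · exact ⟨1, by simp [ind, hi]⟩
  · exact ⟨0, by simp [ind, hi]⟩

/-- Membership in the Rees cone can be tested on integral points. -/
theorem reesCone_eq_of_natCast_mem
    (h : ∀ (m : Fin n → ℕ) (k : ℕ), (∀ S, C.IsMinimalVertexCover S → k ≤ ∑ i ∈ S, m i) →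
      (Fin.snoc (α := fun _ => ℝ) (fun i => (m i : ℝ)) (k : ℝ) : Fin (n + 1) → ℝ) ∈
        reesCone C.incidenceMatrix) :
    reesCone C.incidenceMatrix =
        (⋂ i : Fin (n + 1), posHalfSpace (Pi.single i (1 : ℝ))) ∩
          ⋂ (S : Finset (Fin n)) (_ : C.IsMinimalVertexCover S), posHalfSpace (coverVector S) := by
  refine (reesCone_subset C).antisymm fun z hz => ?_
  obtain ⟨hz0, ht, hzS⟩ := (mem_iInter_posHalfSpace_iff C).1 hz
  by_contra hzc
  obtain ⟨x, hx, hlt⟩ := exists_mem_setCoveringPolyhedron_lt C hz0 ht hzc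
  obtain ⟨hx0, hxe⟩ := (mem_setCoveringPolyhedron_iff C).1 hx
  have hbound : ∀ N : ℕ, N * (z (Fin.last n) - ∑ i, x i * z i.castSucc) ≤ 1 + ∑ i, x i := by
    intro N
    -- Rounding in these directions preserves the cover inequalities and costs at most `1 + ∑ x i`,
    -- whereas the gap grows linearly in `N`.
    have hmem := h (fun i => ⌈N * z i.castSucc⌉₊) ⌊N * z (Fin.last n)⌋₊ fun S hS => by
      have h1 : (⌊N * z (Fin.last n)⌋₊ : ℝ) ≤ ((∑ i ∈ S, ⌈N * z i.castSucc⌉₊ : ℕ) : ℝ) := by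
        push_cast
        calc _ ≤ N * z (Fin.last n) := Nat.floor_le (mul_nonneg N.cast_nonneg ht)
          _ ≤ N * ∑ i ∈ S, z i.castSucc := mul_le_mul_of_nonneg_left (hzS S hS) N.cast_nonneg
          _ ≤ _ := by
            rw [Finset.mul_sum]
            exact Finset.sum_le_sum fun i _ => Nat.le_ceil _
      exact_mod_cast h1
    obtain ⟨u, hu0, hu1, hu2⟩ := (mem_reesCone_iff C).1 hmem
    have h2 := sum_weights_le_sum_mul C hu0 hx0 hxe hu2
    rw [hu1] at h2
    simp only [Fin.snoc_last, Fin.snoc_castSucc, one_mul] at h2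
    have h3 : ∑ i, x i * (⌈N * z i.castSucc⌉₊ : ℝ) ≤ ∑ i, x i * (N * z i.castSucc + 1) :=
      Finset.sum_le_sum fun i _ => mul_le_mul_of_nonneg_left
        (Nat.ceil_lt_add_one (mul_nonneg N.cast_nonneg (hz0 i))).le (hx0 i)
    have h4 : ∑ i, x i * (N * z i.castSucc + 1) = N * ∑ i, x i * z i.castSucc + ∑ i, x i := by
      rw [Finset.mul_sum, ← Finset.sum_add_distrib]
      exact Finset.sum_congr rfl fun i _ => by ring
    have h5 := Nat.lt_floor_add_one (N * z (Fin.last n))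
    linarith
  obtain ⟨N, hN⟩ := exists_nat_gt
    ((1 + ∑ i, x i) / (z (Fin.last n) - ∑ i, x i * z i.castSucc))
  rw [div_lt_iff₀ (by linarith)] at hN
  linarith [hbound N]

end Integrality

/-! ### Powers of ideals generated by variables -/

section VariableIdeals

variable {n : ℕ} (K : Type*) [Field K]

/-- The ideal generated by the variables indexed by `S`. -/
noncomputable def variableIdeal (S : Finset (Fin n)) : Ideal (MvPolynomial (Fin n) K) :=
  Ideal.span (MvPolynomial.X '' (S : Set (Fin n)))

variable {K}

theorem X_mem_variableIdeal_iff {S : Finset (Fin n)} {i : Fin n} :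
    (MvPolynomial.X i : MvPolynomial (Fin n) K) ∈ variableIdeal K S ↔ i ∈ S := by
  rw [variableIdeal, MvPolynomial.mem_ideal_span_X_image]
  simp [MvPolynomial.support_X, Finsupp.single_apply]

theorem variableIdeal_le_iff {S : Finset (Fin n)} {J : Ideal (MvPolynomial (Fin n) K)} :
    variableIdeal K S ≤ J ↔ ∀ i ∈ S, MvPolynomial.X i ∈ J := by
  simp [variableIdeal, Ideal.span_le, Set.subset_def]

/-- It is the kernel of the endomorphism of a domain that kills the variables in `S`. -/
instance variableIdeal_isPrime (S : Finset (Fin n)) : (variableIdeal K S).IsPrime := by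
  let φ : MvPolynomial (Fin n) K →ₐ[K] MvPolynomial (Fin n) K :=
    MvPolynomial.aeval fun i => if i ∈ S then 0 else MvPolynomial.X i
  have h1 : (Ideal.Quotient.mkₐ K (variableIdeal K S)).comp φ =
      Ideal.Quotient.mkₐ K (variableIdeal K S) := by
    refine MvPolynomial.algHom_ext fun i => ?_
    simp only [AlgHom.comp_apply, φ, MvPolynomial.aeval_X]
    split_ifs with hi
    · rw [map_zero, eq_comm]
      exact Ideal.Quotient.eq_zero_iff_mem.2 (X_mem_variableIdeal_iff.2 hi)
    · rfl
  have h2 : variableIdeal K S = RingHom.ker φ := by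
    refine le_antisymm (variableIdeal_le_iff.2 fun i hi => ?_) fun f hf => ?_
    · simp [RingHom.mem_ker, φ, hi]
    · have h3 := DFunLike.congr_fun h1 f
      rw [AlgHom.comp_apply, (RingHom.mem_ker).1 hf, map_zero] at h3
      exact Ideal.Quotient.eq_zero_iff_mem.1 h3.symm
  rw [h2]
  exact RingHom.ker_isPrime φ

/-- Multiplication of the variables in `S` by a new variable. -/
noncomputable def scaleVariables (S : Finset (Fin n)) :
    MvPolynomial (Fin n) K →ₐ[K] (MvPolynomial (Fin n) K)[X] :=
  MvPolynomial.aeval fun i =>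
    if i ∈ S then Polynomial.C (MvPolynomial.X i) * Polynomial.X
    else Polynomial.C (MvPolynomial.X i)

theorem scaleVariables_monomial (S : Finset (Fin n)) (m : Fin n →₀ ℕ) (c : K) :
    scaleVariables S (MvPolynomial.monomial m c) =
      Polynomial.C (MvPolynomial.monomial m c) * Polynomial.X ^ (∑ i ∈ S, m i) := by
  have h : ∀ i, (if i ∈ S then Polynomial.C (MvPolynomial.X i) * Polynomial.X
      else Polynomial.C (MvPolynomial.X i) : (MvPolynomial (Fin n) K)[X]) =
      Polynomial.C (MvPolynomial.X i) * if i ∈ S then Polynomial.X else 1 := by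
    intro i; split_ifs <;> simp
  rw [scaleVariables, MvPolynomial.aeval_monomial, Finsupp.prod_fintype _ _ (by simp)]
  simp only [h, mul_pow, Finset.prod_mul_distrib, ite_pow, one_pow, Finset.prod_ite_mem,
    Finset.univ_inter, Finset.prod_pow_eq_pow_sum]
  rw [MvPolynomial.monomial_eq, Finsupp.prod_fintype _ _ (by simp)]
  simp [mul_assoc, Polynomial.algebraMap_apply, MvPolynomial.algebraMap_eq]

theorem coeff_coeff_scaleVariables (S : Finset (Fin n)) (f : MvPolynomial (Fin n) K) (j : ℕ)
    (m : Fin n →₀ ℕ) :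
    ((scaleVariables S f).coeff j).coeff m = if ∑ i ∈ S, m i = j then f.coeff m else 0 := by
  induction f using MvPolynomial.induction_on' with
  | monomial d c =>
    rw [scaleVariables_monomial, Polynomial.coeff_C_mul, Polynomial.coeff_X_pow]
    by_cases hdm : d = m
    · subst hdm
      split_ifs <;> simp_all
    · simp [MvPolynomial.coeff_monomial, hdm, mul_ite]
      split_ifs <;> simp [MvPolynomial.coeff_monomial, hdm]
  | add p q hp hq =>
    simp only [map_add, Polynomial.coeff_add, MvPolynomial.coeff_add, hp, hq]
    split_ifs <;> simp

theorem X_pow_dvd_scaleVariables_iff {S : Finset (Fin n)} {k : ℕ} {f : MvPolynomial (Fin n) K} :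
    Polynomial.X ^ k ∣ scaleVariables S f ↔ ∀ m ∈ f.support, k ≤ ∑ i ∈ S, m i := by
  rw [Polynomial.X_pow_dvd_iff]
  constructor
  · intro h m hm
    by_contra! hlt
    have := coeff_coeff_scaleVariables S f (∑ i ∈ S, m i) m
    rw [h _ hlt, if_pos rfl, MvPolynomial.coeff_zero] at this
    exact MvPolynomial.mem_support_iff.1 hm this.symm
  · intro h d hd
    ext m
    rw [coeff_coeff_scaleVariables, MvPolynomial.coeff_zero]
    split_ifs with hm
    · by_contra hne
      have := h m (MvPolynomial.mem_support_iff.2 hne)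
      omega
    · rfl

/-- `scaleVariables` turns degree in the variables of `S` into order at `X`, and it sends the ideal
into `(X)`. -/
theorem mem_variableIdeal_pow_iff {S : Finset (Fin n)} {k : ℕ} {f : MvPolynomial (Fin n) K} :
    f ∈ variableIdeal K S ^ k ↔ ∀ m ∈ f.support, k ≤ ∑ i ∈ S, m i := by
  constructor
  · intro hf
    rw [← X_pow_dvd_scaleVariables_iff, ← Ideal.mem_span_singleton, ← Ideal.span_singleton_pow]
    have hle : variableIdeal K S ≤
        (Ideal.span {(Polynomial.X : (MvPolynomial (Fin n) K)[X])}).comap (scaleVariables S) := by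
      refine variableIdeal_le_iff.2 fun i hi => ?_
      simp [Ideal.mem_comap, scaleVariables, hi, Ideal.mem_span_singleton]
    exact Ideal.le_comap_pow _ _ (Ideal.pow_right_mono hle k hf)
  · intro h
    rw [← MvPolynomial.support_sum_monomial_coeff f]
    refine Ideal.sum_mem _ fun m hm => ?_
    rw [MvPolynomial.monomial_eq, Finsupp.prod_fintype _ _ (by simp),
      ← Finset.prod_mul_prod_compl S]
    refine Ideal.mul_mem_left _ _ (Ideal.mul_mem_right _ _ (Ideal.pow_le_pow_right (h m hm) ?_))
    rw [← Finset.prod_pow_eq_pow_sum]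
    exact Ideal.prod_mem_prod fun i hi =>
      Ideal.pow_mem_pow (X_mem_variableIdeal_iff.2 hi) _

end VariableIdeals

/-- If `σ` maps `J` into the ideal `(X)` of `R[X]`, then the valuation at `X` bounds the
coefficients of polynomials integral over the Rees algebra of `J`. -/
theorem X_pow_dvd_map_coeff_of_isIntegral_reesAlgebra {A R : Type*} [CommRing A] [CommRing R]
    [IsDomain R] [IsIntegrallyClosed R] {σ : A →+* R[X]} {J : Ideal A}
    (hJ : ∀ i, ∀ a ∈ J ^ i, Polynomial.X ^ i ∣ σ a)
    {g : A[X]} (hg : IsIntegral (reesAlgebra J) g) (j : ℕ) :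
    Polynomial.X ^ j ∣ σ (g.coeff j) := by
  -- Sending `t` to `X / u` maps the Rees algebra into `R[X][X]`, since `σ a` is divisible by `X ^
  -- i` for `a ∈ J ^ i`. Normality of `R[X][X]` then forces the image of `g` to be a polynomial `b`.
  let u : R[X][X] := Polynomial.C Polynomial.X
  let ι := algebraMap R[X][X] (FractionRing R[X][X])
  have hι : Function.Injective ι := IsFractionRing.injective R[X][X] (FractionRing R[X][X])
  have hu : ι u ≠ 0 := by
    rw [Ne, map_eq_zero_iff ι hι, Polynomial.C_eq_zero]
    exact Polynomial.X_ne_zero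
  let ψ : A[X] →+* FractionRing R[X][X] :=
    Polynomial.eval₂RingHom (ι.comp (Polynomial.C.comp σ)) (ι Polynomial.X / ι u)
  have hψ : ∀ h, ψ h = ∑ i ∈ Finset.range (h.natDegree + 1),
      ι (Polynomial.C (σ (h.coeff i))) * (ι Polynomial.X / ι u) ^ i := fun h =>
    Polynomial.eval₂_eq_sum_range _ _
  have hmem : ∀ h : reesAlgebra J, ψ h ∈ integralClosure R[X][X] (FractionRing R[X][X]) := by
    rintro ⟨h, hh⟩
    rw [hψ]
    refine Subalgebra.sum_mem _ fun i _ => ?_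
    obtain ⟨q, hq⟩ := hJ i _ (hh i)
    have h2 : ι (Polynomial.C (σ (h.coeff i))) * (ι Polynomial.X / ι u) ^ i =
        ι (Polynomial.C q * Polynomial.X ^ i) := by
      have h3 : Polynomial.C (σ (h.coeff i)) = u ^ i * Polynomial.C q := by
        rw [hq, Polynomial.C_mul, Polynomial.C_pow]
      rw [h3, div_pow]
      simp only [map_mul, map_pow]
      field_simp
    simp only [h2]
    exact isIntegral_algebraMap
  have hint : IsIntegral (integralClosure R[X][X] (FractionRing R[X][X])) (ψ g) :=
    hg.map_of_comp_eq ((ψ.comp (reesAlgebra J).val.toRingHom).codRestrict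
      (integralClosure R[X][X] (FractionRing R[X][X])) hmem) ψ (by ext x; rfl)
  have hint' : IsIntegral R[X][X] (ψ g) := isIntegral_trans _ hint
  obtain ⟨b, hb⟩ := IsIntegrallyClosed.isIntegral_iff.1 hint'
  rcases lt_or_ge g.natDegree j with hj | hj
  · simp [Polynomial.coeff_eq_zero_of_natDegree_lt hj]
  set N := g.natDegree
  -- Clearing the denominators `u ^ i` allows comparing coefficients of degree `j`.
  have hB : u ^ N * b = ∑ i ∈ Finset.range (N + 1),
      Polynomial.C (σ (g.coeff i) * Polynomial.X ^ (N - i)) * Polynomial.X ^ i := by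
    apply hι
    rw [map_mul, show ι b = ψ g from hb, hψ, Finset.mul_sum, map_sum]
    refine Finset.sum_congr rfl fun i hi => ?_
    have hi' : N = i + (N - i) := by have := Finset.mem_range.1 hi; omega
    have h3 : (Polynomial.C (σ (g.coeff i) * Polynomial.X ^ (N - i)) : R[X][X]) =
        Polynomial.C (σ (g.coeff i)) * u ^ (N - i) := by
      rw [Polynomial.C_mul, Polynomial.C_pow]
    have h4 : u ^ N = u ^ i * u ^ (N - i) := by rw [← pow_add, ← hi']
    rw [h3, h4, div_pow]
    simp only [map_mul, map_pow]
    field_simp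
  have hco := congrArg (fun p => Polynomial.coeff p j) hB
  simp only [u, ← map_pow, Polynomial.coeff_C_mul, Polynomial.finsetSum_coeff,
    Polynomial.coeff_X_pow] at hco
  rw [Finset.sum_eq_single_of_mem j (Finset.mem_range.2 (by omega))
    (fun i _ hij => by simp [hij.symm])] at hco
  simp only [if_true, mul_one] at hco
  refine ⟨b.coeff j, mul_right_cancel₀ (pow_ne_zero (N - j) Polynomial.X_ne_zero) ?_⟩
  rw [← hco, mul_right_comm, ← pow_add, Nat.add_sub_cancel' hj]

/-! ### Valuation bounds at ideals of variables -/

section VariableIdeals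

variable {n : ℕ} {K : Type*} [Field K]

/-- The Rees algebra of an ideal generated by variables is integrally closed in `R[t]`. -/
theorem coeff_mem_variableIdeal_pow_of_isIntegral {S : Finset (Fin n)}
    {J : Ideal (MvPolynomial (Fin n) K)} (hJ : J ≤ variableIdeal K S)
    {g : (MvPolynomial (Fin n) K)[X]} (hg : IsIntegral (reesAlgebra J) g) (j : ℕ) :
    g.coeff j ∈ variableIdeal K S ^ j := by
  rw [mem_variableIdeal_pow_iff, ← X_pow_dvd_scaleVariables_iff]
  have h : ∀ i, ∀ a ∈ J ^ i, Polynomial.X ^ i ∣ (scaleVariables S).toRingHom a := fun i a ha =>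
    X_pow_dvd_scaleVariables_iff.2 (mem_variableIdeal_pow_iff.1 (Ideal.pow_right_mono hJ i ha))
  exact X_pow_dvd_map_coeff_of_isIntegral_reesAlgebra h hg j

end VariableIdeals

/-! ### Minimal primes, symbolic powers and ordinary powers of the edge ideal -/

section EdgeIdeal

variable {n : ℕ} (C : Clutter n) {K : Type*} [Field K]

/-- A prime containing a product of variables contains one of them, so the variables in a prime over
`I` form a cover, and they generate a smaller prime over `I`. -/
theorem mem_minimalPrimes_edgeIdeal_iff {P : Ideal (MvPolynomial (Fin n) K)} :
    P ∈ (C.edgeIdeal K).minimalPrimes ↔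
      ∃ S, C.IsMinimalVertexCover S ∧ P = variableIdeal K S := by
  have hle : ∀ Q : Ideal (MvPolynomial (Fin n) K), Q.IsPrime →
      (C.edgeIdeal K ≤ Q ↔ ∀ e ∈ C.edges, ∃ i ∈ e, MvPolynomial.X i ∈ Q) := by
    intro Q hQ
    simp only [Clutter.edgeIdeal, Ideal.span_le, Set.image_subset_iff]
    refine forall₂_congr fun e _ => ?_
    exact hQ.prod_mem_iff
  have hcov : ∀ S, C.edgeIdeal K ≤ variableIdeal K S ↔ C.IsVertexCover S := by
    intro S
    rw [hle _ inferInstance]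
    simp only [X_mem_variableIdeal_iff, Clutter.IsVertexCover]
  have hex : ∀ Q : Ideal (MvPolynomial (Fin n) K), Q.IsPrime → C.edgeIdeal K ≤ Q →
      ∃ S, C.IsVertexCover S ∧ variableIdeal K S ≤ Q := by
    classical
    intro Q hQ hQI
    refine ⟨Finset.univ.filter fun i => MvPolynomial.X i ∈ Q, fun e he => ?_, variableIdeal_le_iff.2 fun i hi => ?_⟩
    · obtain ⟨i, hi, hiQ⟩ := (hle Q hQ).1 hQI e he
      exact ⟨i, hi, by simpa using hiQ⟩
    · simpa using hi
  constructor
  · rintro ⟨⟨hP, hPI⟩, hmin⟩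
    obtain ⟨S, hS, hSP⟩ := hex P hP hPI
    obtain ⟨T, hTS, hT⟩ := hS.exists_minimal
    have hTP : variableIdeal K T ≤ P :=
      variableIdeal_le_iff.2 fun i hi => variableIdeal_le_iff.1 hSP i (hTS hi)
    exact ⟨T, hT, le_antisymm (hmin ⟨inferInstance, (hcov T).2 hT.1⟩ hTP) hTP⟩
  · rintro ⟨S, hS, rfl⟩
    refine ⟨⟨inferInstance, (hcov S).2 hS.1⟩, fun Q ⟨hQ, hQI⟩ hQS => ?_⟩
    obtain ⟨T, hT, hTQ⟩ := hex Q hQ hQI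
    have hTS : T ⊆ S := fun i hi =>
      X_mem_variableIdeal_iff.1 (hQS (variableIdeal_le_iff.1 hTQ i hi))
    exact (variableIdeal_le_iff.2 fun i hi => variableIdeal_le_iff.1 hTQ i (hS.2 hT hTS hi))

theorem mem_symbolicPow_edgeIdeal_iff {f : MvPolynomial (Fin n) K} {k : ℕ} :
    f ∈ symbolicPow (C.edgeIdeal K) k ↔
      ∀ S, C.IsMinimalVertexCover S → ∀ m ∈ f.support, k ≤ ∑ i ∈ S, m i := by
  simp only [symbolicPow, Ideal.mem_iInf, mem_minimalPrimes_edgeIdeal_iff]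
  constructor
  · intro h S hS
    exact mem_variableIdeal_pow_iff.1 (h _ ⟨S, hS, rfl⟩)
  · rintro h _ ⟨S, hS, rfl⟩
    exact mem_variableIdeal_pow_iff.2 (h S hS)

theorem coeff_mem_symbolicPow_of_isIntegral {g : (MvPolynomial (Fin n) K)[X]}
    (hg : IsIntegral (reesAlgebra (C.edgeIdeal K)) g) (k : ℕ) :
    g.coeff k ∈ symbolicPow (C.edgeIdeal K) k := by
  simp only [symbolicPow, Ideal.mem_iInf]
  intro P hP
  obtain ⟨S, -, rfl⟩ := (mem_minimalPrimes_edgeIdeal_iff C).1 hP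
  exact coeff_mem_variableIdeal_pow_of_isIntegral hP.1.2 hg k

/-- The exponent vector of the product of the variables in `e`. -/
noncomputable def edgeExponent (e : Finset (Fin n)) : Fin n →₀ ℕ :=
  ∑ i ∈ e, Finsupp.single i 1

theorem prod_X_eq_monomial (e : Finset (Fin n)) :
    ∏ i ∈ e, (MvPolynomial.X i : MvPolynomial (Fin n) K) =
      MvPolynomial.monomial (edgeExponent e) 1 := by
  simp [edgeExponent, MvPolynomial.monomial_sum_one, MvPolynomial.X]

theorem edgeExponent_apply (e : Finset (Fin n)) (i : Fin n) :
    edgeExponent e i = if i ∈ e then 1 else 0 := by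
  simp [edgeExponent, Finsupp.finsetSum_apply, Finsupp.single_apply]

/-- The exponents of the monomials in the `k`-th power of the edge ideal: those that dominate
a sum of `k` edges. -/
def Clutter.powerExponents (k : ℕ) : Set (Fin n →₀ ℕ) :=
  {m | ∃ p : C.edges → ℕ, ∑ e, p e = k ∧
    ∀ i, (∑ e : C.edges, if i ∈ e.1 then p e else 0) ≤ m i}

theorem edgeIdeal_pow_le_span (k : ℕ) :
    C.edgeIdeal K ^ k ≤
      Ideal.span ((fun m => MvPolynomial.monomial m (1 : K)) '' C.powerExponents k) := by
  induction k with
  | zero =>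
    have h0 : (0 : Fin n →₀ ℕ) ∈ C.powerExponents 0 := ⟨0, by simp, by simp⟩
    have h1 : (1 : MvPolynomial (Fin n) K) ∈
        Ideal.span ((fun m => MvPolynomial.monomial m (1 : K)) '' C.powerExponents 0) :=
      Ideal.subset_span ⟨0, h0, by simp [← MvPolynomial.C_apply]⟩
    rw [(Ideal.eq_top_iff_one _).2 h1]
    exact le_top
  | succ k ih =>
    rw [pow_succ]
    refine (Ideal.mul_mono_left ih).trans ?_
    rw [Clutter.edgeIdeal, Ideal.span_mul_span', Ideal.span_le]
    rintro _ ⟨_, ⟨m, ⟨p, hp1, hp2⟩, rfl⟩, _, ⟨e, he, rfl⟩, rfl⟩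
    let e' : C.edges := ⟨e, he⟩
    refine Ideal.subset_span ⟨m + edgeExponent e,
      ⟨p + (Pi.single e' 1 : C.edges → ℕ), ?_, fun i => ?_⟩, ?_⟩
    · simp only [Pi.add_apply, Finset.sum_add_distrib, hp1, Finset.sum_pi_single', Finset.mem_univ,
        if_true]
    · have h1 : (∑ f : C.edges, if i ∈ f.1 then (Pi.single e' 1 : C.edges → ℕ) f else 0) =
          if i ∈ e then 1 else 0 := by
        refine (Finset.sum_eq_single_of_mem e' (Finset.mem_univ _) fun f _ hf => ?_).trans ?_
        · simp [hf]
        · simp [e']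
      have h2 : (∑ f : C.edges, if i ∈ f.1 then (p + (Pi.single e' 1 : C.edges → ℕ)) f else 0) =
          (∑ f : C.edges, if i ∈ f.1 then p f else 0) + if i ∈ e then 1 else 0 := by
        rw [← h1, ← Finset.sum_add_distrib]
        exact Finset.sum_congr rfl fun f _ => by split_ifs <;> simp
      rw [h2, Finsupp.add_apply, edgeExponent_apply]
      exact Nat.add_le_add_right (hp2 i) _
    · simp [prod_X_eq_monomial, MvPolynomial.monomial_mul]

theorem mem_powerExponents_of_mem_support {f : MvPolynomial (Fin n) K} {k : ℕ}
    (hf : f ∈ C.edgeIdeal K ^ k) {m : Fin n →₀ ℕ} (hm : m ∈ f.support) :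
    m ∈ C.powerExponents k := by
  obtain ⟨d, ⟨p, hp1, hp2⟩, hdm⟩ :=
    MvPolynomial.mem_ideal_span_monomial_image.1 (edgeIdeal_pow_le_span C k hf) m hm
  exact ⟨p, hp1, fun i => (hp2 i).trans (hdm i)⟩

theorem monomial_mem_edgeIdeal_pow {k : ℕ} {m : Fin n →₀ ℕ} (hm : m ∈ C.powerExponents k)
    (c : K) : MvPolynomial.monomial m c ∈ C.edgeIdeal K ^ k := by
  obtain ⟨p, rfl, hp⟩ := hm
  have h1 : ∏ e : C.edges, (∏ i ∈ e.1, (MvPolynomial.X i : MvPolynomial (Fin n) K)) ^ p e ∈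
      C.edgeIdeal K ^ ∑ e, p e := by
    rw [← Finset.prod_pow_eq_pow_sum]
    exact Ideal.prod_mem_prod fun e _ =>
      Ideal.pow_mem_pow (Ideal.subset_span (Set.mem_image_of_mem _ e.2)) _
  refine Ideal.mem_of_dvd _ ?_ h1
  have h2 : ∏ e : C.edges, (∏ i ∈ e.1, (MvPolynomial.X i : MvPolynomial (Fin n) K)) ^ p e =
      MvPolynomial.monomial (∑ e : C.edges, p e • edgeExponent e.1) 1 := by
    rw [MvPolynomial.monomial_sum_one]
    exact Finset.prod_congr rfl fun e _ => by
      rw [prod_X_eq_monomial, MvPolynomial.monomial_pow, one_pow]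
  rw [h2, MvPolynomial.monomial_dvd_monomial]
  refine ⟨Or.inr fun i => ?_, one_dvd _⟩
  simpa only [Finsupp.finsetSum_apply, Finsupp.smul_apply, edgeExponent_apply, smul_eq_mul,
    mul_ite, mul_one, mul_zero] using hp i

end EdgeIdeal

/-- Simultaneous Diophantine approximation. -/
theorem exists_int_simultaneous_approx {ι : Type*} [Finite ι] (w : ι → ℝ) {ε : ℝ} (hε : 0 < ε) :
    ∃ N : ℕ, 0 < N ∧ ∃ p : ι → ℤ, ∀ e, |N * w e - p e| < ε := by
  have := Fintype.ofFinite ι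
  obtain ⟨a, -, φ, hφ, hlim⟩ := tendsto_subseq_of_bounded
    (s := Set.Icc (0 : ι → ℝ) 1) (Metric.isBounded_Icc _ _)
    (x := fun N : ℕ => fun e => Int.fract (N * w e))
    (fun N => ⟨fun e => Int.fract_nonneg _, fun e => (Int.fract_lt_one _).le⟩)
  obtain ⟨M, hM⟩ := Metric.cauchySeq_iff.1 hlim.cauchySeq ε hε
  have hd := hM (M + 1) (Nat.le_succ M) M le_rfl
  have hlt : φ M < φ (M + 1) := hφ (Nat.lt_succ_self M)
  -- Along a convergent subsequence of the fractional parts of `N * w`, two late terms are close,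
  -- and the difference of their indices works.
  refine ⟨φ (M + 1) - φ M, Nat.sub_pos_of_lt hlt,
    fun e => ⌊φ (M + 1) * w e⌋ - ⌊φ M * w e⌋, fun e => ?_⟩
  have h1 := (dist_le_pi_dist _ _ e).trans_lt hd
  rw [Real.dist_eq] at h1
  refine lt_of_eq_of_lt (congrArg _ ?_) h1
  rw [Nat.cast_sub hlt.le]
  simp only [Function.comp_apply, Int.fract]
  push_cast
  ring

/-! ### Integral points of the Rees cone and powers of the ideal -/

section ReesCone

variable {n : ℕ} (C : Clutter n) {K : Type*} [Field K]

theorem exists_nsmul_mem_powerExponents {m : Fin n →₀ ℕ} {k : ℕ}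
    (h : (Fin.snoc (α := fun _ => ℝ) (fun i => (m i : ℝ)) (k : ℝ) : Fin (n + 1) → ℝ) ∈
        reesCone C.incidenceMatrix) :
    ∃ N : ℕ, 0 < N ∧ N • m ∈ C.powerExponents (N * k) := by
  obtain ⟨w, hw0, hw1, hw2⟩ := (mem_reesCone_iff C).1 h
  simp only [Fin.snoc_last, Fin.snoc_castSucc] at hw1 hw2
  -- With error below `q⁻¹` per edge, any subset of edges accumulates an error below `1`, so
  -- integrality makes the total exactly `N * k` and preserves the coordinate bounds.
  set q : ℝ := (C.edges.card : ℝ) + 1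
  have hq : 1 ≤ q := by simp [q]
  have hcard : ((Finset.univ : Finset C.edges).card : ℝ) * q⁻¹ < 1 := by
    rw [Finset.card_univ, Fintype.card_coe, ← div_eq_mul_inv, div_lt_one (by linarith)]
    simp [q]
  obtain ⟨N, hN, p, hp⟩ := exists_int_simultaneous_approx w (ε := q⁻¹) (by positivity)
  have hNpos : (0 : ℝ) < N := by exact_mod_cast hN
  have hq1 : q⁻¹ ≤ 1 := inv_le_one_of_one_le₀ hq
  have hp0 : ∀ e, 0 ≤ p e := by
    intro e
    have h1 := (abs_lt.1 (hp e)).2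
    have h2 := mul_nonneg hNpos.le (hw0 e)
    have h3 : (-1 : ℝ) < p e := by linarith
    have h4 : (-1 : ℤ) < p e := by exact_mod_cast h3
    omega
  lift p to C.edges → ℕ using hp0
  simp only [Int.cast_natCast] at hp
  have key : ∀ s : C.edges → Prop, ∀ _ : DecidablePred s,
      |N * (∑ e, if s e then w e else 0) - ((∑ e, if s e then p e else 0 : ℕ) : ℝ)| < 1 := by
    intro s _
    push_cast
    rw [Finset.mul_sum, ← Finset.sum_sub_distrib]
    refine (Finset.abs_sum_le_sum_abs _ _).trans_lt (lt_of_le_of_lt ?_ hcard)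
    rw [← nsmul_eq_mul, ← Finset.sum_const]
    refine Finset.sum_le_sum fun e _ => ?_
    split_ifs
    · exact (hp e).le
    · simp
      positivity
  refine ⟨N, hN, p, ?_, fun i => ?_⟩
  · have h1 := key (fun _ => True) inferInstance
    simp only [if_true, hw1] at h1
    have h2 : |((N * k : ℕ) : ℤ) - ((∑ e, p e : ℕ) : ℤ)| < 1 := by exact_mod_cast h1
    have h3 := Int.abs_lt_one_iff.1 h2
    omega
  · have h1 := (abs_lt.1 (key (fun e => i ∈ e.1) inferInstance)).1
    have h2 := mul_le_mul_of_nonneg_left (hw2 i) hNpos.le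
    have h3 : ((∑ e : C.edges, if i ∈ e.1 then p e else 0 : ℕ) : ℝ) < ((N * m i + 1 : ℕ) : ℝ) := by
      push_cast at h1 ⊢
      linarith
    have h4 := Nat.cast_lt.1 h3
    simp only [Finsupp.smul_apply, smul_eq_mul]
    omega

theorem snoc_mem_reesCone_of_nsmul_mem_powerExponents {m : Fin n → ℕ} {k N : ℕ} (hN : 0 < N)
    {d : Fin n →₀ ℕ} (hd : ∀ i, d i = N * m i) (h : d ∈ C.powerExponents (N * k)) :
    (Fin.snoc (α := fun _ => ℝ) (fun i => (m i : ℝ)) (k : ℝ) : Fin (n + 1) → ℝ) ∈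
        reesCone C.incidenceMatrix := by
  obtain ⟨p, hp1, hp2⟩ := h
  have hNpos : (0 : ℝ) < N := by exact_mod_cast hN
  refine (mem_reesCone_iff C).2 ⟨fun e => (p e : ℝ) / N, fun e => by positivity, ?_, fun i => ?_⟩
  · rw [← Finset.sum_div, Fin.snoc_last, div_eq_iff hNpos.ne', mul_comm]
    exact_mod_cast hp1
  · have h1 : (∑ e : C.edges, if i ∈ e.1 then (p e : ℝ) / N else 0) =
        ((∑ e : C.edges, if i ∈ e.1 then p e else 0 : ℕ) : ℝ) / N := by
      push_cast
      rw [Finset.sum_div]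
      exact Finset.sum_congr rfl fun e _ => by split_ifs <;> simp
    rw [h1, Fin.snoc_castSucc, div_le_iff₀ hNpos, mul_comm]
    have := hp2 i
    rw [hd i] at this
    exact_mod_cast this

end ReesCone

/-! ### Integral closures of the Rees algebra and of powers -/

section IntegralClosure

/-- Homogeneous elements of `R[t]` that are integral over the Rees algebra come from the integral
closures of the powers of the ideal. -/
theorem mem_integralClosureIdeal_of_isIntegral_monomial {R : Type*} [CommRing R] {J : Ideal R}
    {i : ℕ} {f : R} (h : IsIntegral (reesAlgebra J) (Polynomial.monomial i f)) :
    f ∈ integralClosureIdeal (J ^ i) := by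
  obtain ⟨p, hp, hpe⟩ := h
  rcases subsingleton_or_nontrivial R with hR | hR
  · exact ⟨1, le_rfl, 0, fun k => by simp, Subsingleton.elim _ _⟩
  -- The factor `X` guarantees degree at least `1`.
  have hmul : (Polynomial.X * p).Monic := Polynomial.monic_X.mul hp
  have hq : Polynomial.eval₂ (algebraMap (reesAlgebra J) R[X]) (Polynomial.monomial i f)
      (Polynomial.X * p) = 0 := by
    rw [Polynomial.eval₂_mul, hpe, mul_zero]
  set q := Polynomial.X * p with hqdef
  set m := q.natDegree with hm
  have hm1 : 1 ≤ m := by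
    rw [hm, hqdef, Polynomial.natDegree_X_mul hp.ne_zero]
    omega
  -- These are the parts that contribute to degree `i * m` in `t`.
  refine ⟨m, hm1, fun k => (q.coeff (m - k) : R[X]).coeff (i * k), fun k => ?_, ?_⟩
  · rw [← pow_mul]
    exact (q.coeff (m - k)).2 (i * k)
  · have h1 := congrArg (fun g => Polynomial.coeff g (i * m)) hq
    simp only [Polynomial.eval₂_eq_sum_range, Polynomial.finsetSum_coeff,
      Polynomial.coeff_zero] at h1
    rw [← hm, Finset.sum_range_succ, show q.coeff m = 1 from hmul] at h1
    have h2 : ∀ j ≤ m, ∀ a : reesAlgebra J,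
        (algebraMap (reesAlgebra J) R[X] a * Polynomial.monomial i f ^ j).coeff (i * m) =
          (a : R[X]).coeff (i * (m - j)) * f ^ j := by
      intro j hj a
      have h3 : i * m = i * (m - j) + i * j := by rw [← mul_add, Nat.sub_add_cancel hj]
      rw [Polynomial.monomial_pow, h3, Polynomial.coeff_mul_monomial]
      rfl
    rw [h2 m le_rfl] at h1
    rw [Finset.sum_congr rfl fun j hj => h2 j (Finset.mem_range.1 hj).le _] at h1
    rw [add_comm] at h1
    rw [← h1]
    congr 1
    · simp
    · refine Finset.sum_nbij' (fun k => m - k) (fun j => m - j) ?_ ?_ ?_ ?_ ?_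
      · intro k hk
        simp only [Finset.mem_Icc, Finset.mem_range] at hk ⊢
        omega
      · intro k hk
        simp only [Finset.mem_Icc, Finset.mem_range] at hk ⊢
        omega
      · intro k hk
        simp only [Finset.mem_Icc] at hk
        omega
      · intro k hk
        simp only [Finset.mem_range] at hk
        omega
      · intro k hk
        rw [Nat.sub_sub_self (Finset.mem_Icc.1 hk).2]

theorem isIntegral_monomial_of_mem_integralClosureIdeal {R : Type*} [CommRing R] {J : Ideal R}
    {i : ℕ} {f : R} (h : f ∈ integralClosureIdeal (J ^ i)) :
    IsIntegral (reesAlgebra J) (Polynomial.monomial i f) := by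
  obtain ⟨m, -, a, ha, heq⟩ := h
  have ha' : ∀ k, Polynomial.monomial (i * k) (a k) ∈ reesAlgebra J := fun k =>
    reesAlgebra.monomial_mem.2 (by rw [pow_mul]; exact ha k)
  let A : ℕ → reesAlgebra J := fun k => ⟨_, ha' k⟩
  refine ⟨Polynomial.X ^ m + ∑ k ∈ Finset.Icc 1 m, Polynomial.C (A k) * Polynomial.X ^ (m - k),
    Polynomial.monic_X_pow_add ?_, ?_⟩
  · refine (Polynomial.degree_sum_le _ _).trans_lt ?_
    refine (Finset.sup_lt_iff (WithBot.bot_lt_coe m)).2 fun k hk => ?_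
    refine (Polynomial.degree_C_mul_X_pow_le _ _).trans_lt ?_
    have := Finset.mem_Icc.1 hk
    exact Nat.cast_lt.2 (by omega)
  · have h1 : ∀ k ∈ Finset.Icc 1 m, algebraMap (reesAlgebra J) R[X] (A k) *
        Polynomial.monomial i f ^ (m - k) = Polynomial.monomial (i * m) (a k * f ^ (m - k)) := by
      intro k hk
      rw [show algebraMap (reesAlgebra J) R[X] (A k) = Polynomial.monomial (i * k) (a k) from rfl,
        Polynomial.monomial_pow, Polynomial.monomial_mul_monomial, ← mul_add,
        Nat.add_sub_cancel' (Finset.mem_Icc.1 hk).2]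
    rw [Polynomial.eval₂_add, Polynomial.eval₂_X_pow, Polynomial.eval₂_finsetSum]
    simp only [Polynomial.eval₂_mul, Polynomial.eval₂_C, Polynomial.eval₂_X_pow]
    rw [Finset.sum_congr rfl h1, Polynomial.monomial_pow, ← map_sum, ← map_add, heq, map_zero]

variable {n : ℕ} (C : Clutter n) {K : Type*} [Field K]

/-- In degree `N • m` the leading term must be cancelled, so some `a j` in `I ^ (k * j)` involves
the monomial `j • m`. -/
theorem mem_reesCone_of_monomial_mem_integralClosureIdeal {k : ℕ} {m : Fin n →₀ ℕ}
    (h : MvPolynomial.monomial m (1 : K) ∈ integralClosureIdeal (C.edgeIdeal K ^ k)) :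
    (Fin.snoc (α := fun _ => ℝ) (fun i => (m i : ℝ)) (k : ℝ) : Fin (n + 1) → ℝ) ∈
        reesCone C.incidenceMatrix := by
  obtain ⟨N, -, a, ha, heq⟩ := h
  have h1 := congrArg (MvPolynomial.coeff (N • m)) heq
  rw [MvPolynomial.coeff_add, MvPolynomial.coeff_sum, MvPolynomial.monomial_pow, one_pow,
    MvPolynomial.coeff_monomial, if_pos rfl, MvPolynomial.coeff_zero] at h1
  have h2 : ∃ j ∈ Finset.Icc 1 N,
      MvPolynomial.coeff (N • m) (a j * MvPolynomial.monomial m (1 : K) ^ (N - j)) ≠ 0 := by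
    by_contra! hcon
    rw [Finset.sum_eq_zero hcon, add_zero] at h1
    exact one_ne_zero h1
  obtain ⟨j, hj, hne⟩ := h2
  obtain ⟨hj1, hjN⟩ := Finset.mem_Icc.1 hj
  have h3 : N • m = j • m + (N - j) • m := by rw [← add_smul, Nat.add_sub_cancel' hjN]
  rw [MvPolynomial.monomial_pow, one_pow, h3, MvPolynomial.coeff_mul_monomial, mul_one] at hne
  have h4 := ha j
  rw [← pow_mul, mul_comm] at h4
  exact snoc_mem_reesCone_of_nsmul_mem_powerExponents C hj1 (fun i => by simp)
    (mem_powerExponents_of_mem_support C h4 (MvPolynomial.mem_support_iff.2 hne))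

/-- Each term of `g` has its exponent in the cone, so a positive power of it lies in the Rees
algebra. -/
theorem isIntegral_of_mem_symbolicReesAlgebra
    (h : reesCone C.incidenceMatrix =
        (⋂ i : Fin (n + 1), posHalfSpace (Pi.single i (1 : ℝ))) ∩
          ⋂ (S : Finset (Fin n)) (_ : C.IsMinimalVertexCover S), posHalfSpace (coverVector S))
    {g : (MvPolynomial (Fin n) K)[X]} (hg : g ∈ symbolicReesAlgebra (C.edgeIdeal K)) :
    IsIntegral (reesAlgebra (C.edgeIdeal K)) g := by
  rw [g.as_sum_support]
  refine IsIntegral.sum _ fun k _ => ?_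
  rw [← MvPolynomial.support_sum_monomial_coeff (g.coeff k), map_sum]
  refine IsIntegral.sum _ fun m hm => ?_
  have hmem : (Fin.snoc (α := fun _ => ℝ) (fun i => (m i : ℝ)) (k : ℝ) : Fin (n + 1) → ℝ) ∈
      reesCone C.incidenceMatrix := by
    rw [h, mem_iInter_posHalfSpace_iff]
    refine ⟨by simp, by simp, fun S hS => ?_⟩
    have := (mem_symbolicPow_edgeIdeal_iff C).1 (hg k) S hS m hm
    simp only [Fin.snoc_last, Fin.snoc_castSucc]
    exact_mod_cast this
  obtain ⟨N, hN, hNm⟩ := exists_nsmul_mem_powerExponents C hmem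
  refine IsIntegral.of_pow hN ?_
  rw [Polynomial.monomial_pow, MvPolynomial.monomial_pow, mul_comm]
  have h1 : Polynomial.monomial (N * k) (MvPolynomial.monomial (N • m) ((g.coeff k).coeff m ^ N)) ∈
      reesAlgebra (C.edgeIdeal K) :=
    reesAlgebra.monomial_mem.2 (monomial_mem_edgeIdeal_pow C hNm _)
  exact isIntegral_algebraMap (x := (⟨_, h1⟩ : reesAlgebra (C.edgeIdeal K)))

/-- Over a normal domain, the integral closure of the Rees algebra consists of polynomials. -/
theorem integralClosureReesAlgebra_eq_image {R : Type*} [CommRing R] [IsDomain R]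
    [IsIntegrallyClosed R] (J : Ideal R) :
    integralClosureReesAlgebra J =
      algebraMap R[X] (FractionRing R[X]) '' {g | IsIntegral (reesAlgebra J) g} := by
  have hinj := IsFractionRing.injective R[X] (FractionRing R[X])
  ext z
  constructor
  · rintro ⟨-, hz⟩
    obtain ⟨g, rfl⟩ := IsIntegrallyClosed.isIntegral_iff.1 (hz.tower_top (A := R[X]))
    refine ⟨g, ?_, rfl⟩
    exact (isIntegral_algHom_iff (IsScalarTower.toAlgHom (reesAlgebra J) R[X] _) hinj).1 hz
  · rintro ⟨g, hg, rfl⟩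
    refine ⟨?_, hg.map (IsScalarTower.toAlgHom (reesAlgebra J) R[X] (FractionRing R[X]))⟩
    have hsub : ∀ h ∈ reesAlgebra J, algebraMap R[X] (FractionRing R[X]) h ∈ Subfield.closure
        (algebraMap R[X] (FractionRing R[X]) '' (reesAlgebra J : Set R[X])) := fun h hh =>
      Subfield.subset_closure ⟨h, hh, rfl⟩
    have hC : ∀ r : R, Polynomial.C r ∈ reesAlgebra J := fun r =>
      (reesAlgebra J).algebraMap_mem r
    -- For `J = ⊥` the fraction field does not contain `t`; the valuation bound with `σ = C` shows
    -- that `g` is constant. Otherwise `t = (a t) / a` for any nonzero `a ∈ J`.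
    by_cases hJ : J = ⊥
    · refine hsub g fun j => ?_
      rcases Nat.eq_zero_or_pos j with rfl | hj
      · simp
      have h1 : ∀ i, ∀ a ∈ J ^ i, (Polynomial.X : R[X]) ^ i ∣ Polynomial.C a := by
        intro i a ha
        rcases Nat.eq_zero_or_pos i with rfl | hi
        · simp
        · rw [hJ, Ideal.bot_pow hi.ne', Ideal.mem_bot] at ha
          simp [ha]
      have h2 := Polynomial.X_pow_dvd_iff.1
        (X_pow_dvd_map_coeff_of_isIntegral_reesAlgebra h1 hg j) 0 hj
      rw [Polynomial.coeff_C_zero] at h2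
      rw [h2]
      exact zero_mem _
    · obtain ⟨a, haJ, ha0⟩ := Submodule.exists_mem_ne_zero_of_ne_bot hJ
      have hX : algebraMap R[X] (FractionRing R[X]) Polynomial.X ∈ Subfield.closure
          (algebraMap R[X] (FractionRing R[X]) '' (reesAlgebra J : Set R[X])) := by
        have h1 : algebraMap R[X] (FractionRing R[X]) (Polynomial.C a) ≠ 0 := by
          rw [Ne, map_eq_zero_iff _ hinj, Polynomial.C_eq_zero]
          exact ha0
        have h2 : algebraMap R[X] (FractionRing R[X]) Polynomial.X =
            algebraMap R[X] (FractionRing R[X]) (Polynomial.monomial 1 a) /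
              algebraMap R[X] (FractionRing R[X]) (Polynomial.C a) := by
          rw [eq_div_iff h1, ← map_mul, Polynomial.X_mul_C, Polynomial.C_mul_X_eq_monomial]
        rw [h2]
        exact div_mem (hsub _ (reesAlgebra.monomial_mem.2 (by simpa using haJ))) (hsub _ (hC a))
      rw [g.as_sum_range_C_mul_X_pow, map_sum]
      refine sum_mem fun i _ => ?_
      rw [map_mul, map_pow]
      exact mul_mem (hsub _ (hC _)) (pow_mem hX i)

theorem integralClosureReesAlgebra_eq_symbolicReesAlgebra_iff :
    integralClosureReesAlgebra (C.edgeIdeal K) =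
        algebraMap (MvPolynomial (Fin n) K)[X] (FractionRing (MvPolynomial (Fin n) K)[X]) ''
          (symbolicReesAlgebra (C.edgeIdeal K) : Set (MvPolynomial (Fin n) K)[X]) ↔
      ∀ g ∈ symbolicReesAlgebra (C.edgeIdeal K), IsIntegral (reesAlgebra (C.edgeIdeal K)) g := by
  rw [integralClosureReesAlgebra_eq_image, (Set.image_injective.2
    (IsFractionRing.injective (MvPolynomial (Fin n) K)[X] _)).eq_iff]
  exact ⟨fun h g hg => h.ge hg, fun h =>
    Set.Subset.antisymm (fun g hg k => coeff_mem_symbolicPow_of_isIntegral C hg k) h⟩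

end IntegralClosure

theorem corollary3p12 {K : Type*} [Field K] {n : ℕ} (C : Clutter n) :
    List.TFAE [
      HasOnlyIntegralVertices (setCoveringPolyhedron C.incidenceMatrix),
      reesCone C.incidenceMatrix =
        (⋂ i : Fin (n + 1), posHalfSpace (Pi.single i (1 : ℝ))) ∩
          ⋂ (S : Finset (Fin n)) (_ : C.IsMinimalVertexCover S), posHalfSpace (coverVector S),
      integralClosureReesAlgebra (C.edgeIdeal K) =
        algebraMap (MvPolynomial (Fin n) K)[X] (FractionRing (MvPolynomial (Fin n) K)[X]) ''
          (symbolicReesAlgebra (C.edgeIdeal K) : Set (MvPolynomial (Fin n) K)[X]),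
      ∀ i : ℕ, 1 ≤ i →
        integralClosureIdeal (C.edgeIdeal K ^ i) =
          (symbolicPow (C.edgeIdeal K) i : Set (MvPolynomial (Fin n) K))] := by
  tfae_have 1 → 2 := reesCone_eq_of_hasOnlyIntegralVertices C
  tfae_have 2 → 1 := hasOnlyIntegralVertices_of_reesCone_eq C
  tfae_have 2 → 3 := fun h => (integralClosureReesAlgebra_eq_symbolicReesAlgebra_iff C).2
    fun g hg => isIntegral_of_mem_symbolicReesAlgebra C h hg
  tfae_have 3 → 4 := by
    intro h i _
    rw [integralClosureReesAlgebra_eq_symbolicReesAlgebra_iff] at h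
    refine Set.Subset.antisymm (fun f hf => ?_) fun f hf => ?_
    · have := coeff_mem_symbolicPow_of_isIntegral C
        (isIntegral_monomial_of_mem_integralClosureIdeal hf) i
      rwa [Polynomial.coeff_monomial_same] at this
    · refine mem_integralClosureIdeal_of_isIntegral_monomial (h _ fun j => ?_)
      rw [Polynomial.coeff_monomial]
      split_ifs with hij
      · exact hij ▸ hf
      · exact zero_mem _
  tfae_have 4 → 2 := by
    intro h
    refine reesCone_eq_of_natCast_mem C fun m k hk => ?_
    -- Exponent `0` is not covered by (c'), but there the zero weights suffice.
    rcases Nat.eq_zero_or_pos k with rfl | hk0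
    · exact (mem_reesCone_iff C).2 ⟨0, by simp, by simp, by simp⟩
    · refine mem_reesCone_of_monomial_mem_integralClosureIdeal C (K := K)
        (m := Finsupp.equivFunOnFinite.symm m) ?_
      rw [h k hk0]
      refine (mem_symbolicPow_edgeIdeal_iff C).2 fun S hS d hd => ?_
      rw [Finset.mem_singleton.1 (MvPolynomial.support_monomial_subset hd)]
      exact hk S hS
  tfae_finish
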